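/- Let $L^1(\mathbb R)$ be the complex Banach space of (classes of) Lebesgue integrable functions on $\mathbb R$, and equip it with the cosine convolution $$(f\star_c g)(x)=\int_{\mathbb R} f(y)\,\frac{g(x+y)+g(x-y)}{2}\,dy ,$$ which makes it a (non-unital, non-commutative) Banach algebra. Let $\Delta(L^1(\mathbb R),\star_c)$ be its structure space, i.e. the set of all nonzero continuous $\mathbb C$-linear functionals $m:L^1(\mathbb R)\to\mathbb C$ with $m(f\star_c g)=m(f)m(g)$ for all $f,g$, endowed with the weak* topology. For $f\in L^1(\mathbb R)$ let $\widehat f\in C_0(\Delta(L^1(\mathbb R),\star_c))$, $\widehat f(m)=m(f)$, be its Gelfand transform. Theorem. There is a homeomorphism $h:\Delta(L^1(\mathbb R),\star_c)\to[0,\infty)$ such that, for every $m\in\Delta(L^1(\mathbb R),\star_c)$ and every $y\in[0,\infty)$, one has $h(m)=y$ if and only if $$m(f)=\int_{\mathbb R} f(x)\cos(2\pi yx)\,dx\qquad\text{for all } f\in L^1(\mathbb R).$$ Consequently, under the identification of $\Delta(L^1(\mathbb R),\star_c)$ with $[0,\infty)$ by $h$, the Gelfand transform is the classical cosine transform: $$\widehat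 f(h^{-1}(y))=\int_{\mathbb R} f(x)\cos(2\pi yx)\,dx\qquad\text{for all } f\in L^1(\mathbb R),\ y\in[0,\infty).$$ -/

import Mathlib

open MeasureTheory Filter Topology
open scoped NNReal Convolution ZeroAtInfty

noncomputable section

namespace CosineGelfand

/-! ### The cosine convolution of functions on the real line -/

/-- The cosine convolution `(f ⋆_c g)(x) = ∫ f(y) (g(x+y) + g(x-y)) / 2 dy`. -/
def cosConv (f g : ℝ → ℂ) (x : ℝ) : ℂ :=
  ∫ y : ℝ, f y * ((g (x + y) + g (x - y)) / 2)

/-- The even part of a function; a tool for the algebra laws below. -/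
def evenPart (f : ℝ → ℂ) (x : ℝ) : ℂ := (f x + f (-x)) / 2

/-- The usual convolution of complex functions on the real line (abbreviation). -/
def usualConv (f g : ℝ → ℂ) : ℝ → ℂ :=
  MeasureTheory.convolution f g (ContinuousLinearMap.mul ℝ ℂ) volume

theorem conv_apply (f g : ℝ → ℂ) (x : ℝ) : usualConv f g x = ∫ y, f y * g (x - y) := rfl

theorem integrable_evenPart {f : ℝ → ℂ} (hf : Integrable f) : Integrable (evenPart f) :=
  (hf.add hf.comp_neg).div_const 2

theorem integrable_conv {f g : ℝ → ℂ} (hf : Integrable f) (hg : Integrable g) :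
    Integrable (usualConv f g) :=
  hf.integrable_convolution (ContinuousLinearMap.mul ℝ ℂ) hg

theorem ae_integrable_conv {f g : ℝ → ℂ} (hf : Integrable f) (hg : Integrable g) :
    ∀ᵐ x : ℝ, Integrable (fun y => f y * g (x - y)) :=
  hf.ae_convolution_exists (ContinuousLinearMap.mul ℝ ℂ) hg

theorem ae_integrable_conv_add {f g : ℝ → ℂ} (hf : Integrable f) (hg : Integrable g) :
    ∀ᵐ x : ℝ, Integrable (fun y => f y * g (x + y)) := by
  filter_upwards [ae_integrable_conv hf.comp_neg hg] with x hx
  simpa using hx.comp_neg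

theorem cosConv_ae_eq {f g : ℝ → ℂ} (hf : Integrable f) (hg : Integrable g) :
    cosConv f g =ᵐ[volume] usualConv (evenPart f) g := by
  filter_upwards [ae_integrable_conv hf hg, ae_integrable_conv_add hf hg,
    ae_integrable_conv hf.comp_neg hg] with x h1 h2 h3
  have e1 : cosConv f g x
      = ((∫ y, f y * g (x + y)) + ∫ y, f y * g (x - y)) / 2 := by
    rw [← integral_add h2 h1, ← integral_div]
    exact integral_congr_ae (Eventually.of_forall fun y => by ring)
  have e2 : usualConv (evenPart f) g x
      = ((∫ y, f (-y) * g (x - y)) + ∫ y, f y * g (x - y)) / 2 := by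
    rw [← integral_add h3 h1, ← integral_div, conv_apply]
    exact integral_congr_ae (Eventually.of_forall fun y => by simp only [evenPart]; ring)
  have e3 : (∫ y, f y * g (x + y)) = ∫ y, f (-y) * g (x - y) := by
    rw [← integral_neg_eq_self]
    simp [sub_eq_add_neg]
  rw [e1, e2, e3]

theorem integrable_cosConv {f g : ℝ → ℂ} (hf : Integrable f) (hg : Integrable g) :
    Integrable (cosConv f g) :=
  (integrable_conv (integrable_evenPart hf) hg).congr (cosConv_ae_eq hf hg).symm

theorem ae_comp_add {g g' : ℝ → ℂ} (h : g =ᵐ[volume] g') (x : ℝ) :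
    (fun y => g (x + y)) =ᵐ[volume] fun y => g' (x + y) :=
  (measurePreserving_add_left volume x).quasiMeasurePreserving.ae_eq_comp h

theorem ae_comp_sub {g g' : ℝ → ℂ} (h : g =ᵐ[volume] g') (x : ℝ) :
    (fun y => g (x - y)) =ᵐ[volume] fun y => g' (x - y) :=
  (Measure.measurePreserving_sub_left volume x).quasiMeasurePreserving.ae_eq_comp h

theorem cosConv_congr {f f' g g' : ℝ → ℂ} (hf : f =ᵐ[volume] f') (hg : g =ᵐ[volume] g') :
    cosConv f g = cosConv f' g' := by
  ext x
  refine integral_congr_ae ?_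
  filter_upwards [hf, ae_comp_add hg x, ae_comp_sub hg x] with y h1 h2 h3
  rw [h1, h2, h3]

theorem conv_congr {f f' g g' : ℝ → ℂ} (hf : f =ᵐ[volume] f') (hg : g =ᵐ[volume] g') :
    usualConv f g = usualConv f' g' := by
  ext x
  refine integral_congr_ae ?_
  filter_upwards [hf, ae_comp_sub hg x] with y h1 h3
  simp only [ContinuousLinearMap.mul_apply']
  rw [h1, h3]

theorem evenPart_congr {f f' : ℝ → ℂ} (hf : f =ᵐ[volume] f') :
    evenPart f =ᵐ[volume] evenPart f' := by
  have h2 : (fun y => f (-y)) =ᵐ[volume] fun y => f' (-y) :=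
    (Measure.measurePreserving_neg volume).quasiMeasurePreserving.ae_eq_comp hf
  filter_upwards [hf, h2] with y h1 h2
  simp only [evenPart, h1, h2]

theorem conv_add_left {f₁ f₂ g : ℝ → ℂ} (h₁ : Integrable f₁) (h₂ : Integrable f₂)
    (hg : Integrable g) : usualConv (f₁ + f₂) g =ᵐ[volume] usualConv f₁ g + usualConv f₂ g := by
  filter_upwards [ae_integrable_conv h₁ hg, ae_integrable_conv h₂ hg] with x a b
  simp only [Pi.add_apply, conv_apply, add_mul]
  exact integral_add a b

theorem conv_add_right {f g₁ g₂ : ℝ → ℂ} (hf : Integrable f) (h₁ : Integrable g₁)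
    (h₂ : Integrable g₂) : usualConv f (g₁ + g₂) =ᵐ[volume] usualConv f g₁ + usualConv f g₂ := by
  filter_upwards [ae_integrable_conv hf h₁, ae_integrable_conv hf h₂] with x a b
  simp only [Pi.add_apply, conv_apply, mul_add]
  exact integral_add a b

theorem evenPart_conv {f g : ℝ → ℂ} (hf : Integrable f) (hg : Integrable g) :
    evenPart (usualConv (evenPart f) g) =ᵐ[volume] usualConv (evenPart f) (evenPart g) := by
  have hE := integrable_evenPart hf
  filter_upwards [ae_integrable_conv hE hg, ae_integrable_conv hE hg.comp_neg] with x a b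
  have e1 : usualConv (evenPart f) g (-x) = ∫ y, evenPart f y * g (-(x - y)) := by
    rw [conv_apply, ← integral_neg_eq_self]
    refine integral_congr_ae (Eventually.of_forall fun y => ?_)
    simp only [evenPart, neg_neg]
    rw [show -x - -y = -(x - y) by ring]
    ring
  have e2 : usualConv (evenPart f) (evenPart g) x
      = ((∫ y, evenPart f y * g (x - y)) + ∫ y, evenPart f y * g (-(x - y))) / 2 := by
    rw [← integral_add a b, ← integral_div, conv_apply]
    refine integral_congr_ae (Eventually.of_forall fun y => ?_)
    have e3 : evenPart g (x - y) = (g (x - y) + g (-(x - y))) / 2 := rfl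
    simp only [e3]
    ring
  rw [e2, ← e1, ← conv_apply]
  rfl

theorem conv_assoc {f g k : ℝ → ℂ} (hf : Integrable f) (hg : Integrable g)
    (hk : Integrable k) : usualConv (usualConv f g) k =ᵐ[volume] usualConv f (usualConv g k) := by
  have hgk : Integrable ((fun x => ‖g x‖) ⋆[ContinuousLinearMap.mul ℝ ℝ, volume]
      fun x => ‖k x‖) :=
    hg.norm.integrable_convolution (ContinuousLinearMap.mul ℝ ℝ) hk.norm
  filter_upwards [hf.norm.ae_convolution_exists (ContinuousLinearMap.mul ℝ ℝ) hgk] with x hx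
  exact convolution_assoc _ _ _ _ (fun a b c => mul_assoc a b c) hf.aestronglyMeasurable
    hg.aestronglyMeasurable hk.aestronglyMeasurable
    (hf.ae_convolution_exists (ContinuousLinearMap.mul ℝ ℂ) hg)
    (hg.norm.ae_convolution_exists (ContinuousLinearMap.mul ℝ ℝ) hk.norm) hx

theorem integral_norm_cosConv_le {f g : ℝ → ℂ} (hf : Integrable f) (hg : Integrable g) :
    ∫ x, ‖cosConv f g x‖ ≤ (∫ x, ‖f x‖) * ∫ x, ‖g x‖ := by
  have hE := integrable_evenPart hf
  have h1 : ∫ x, ‖cosConv f g x‖ = ∫ x, ‖usualConv (evenPart f) g x‖ :=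
    integral_congr_ae ((cosConv_ae_eq hf hg).fun_comp norm)
  have h2 : ∫ x, ‖usualConv (evenPart f) g x‖ ≤
      ∫ x, ((fun x => ‖evenPart f x‖) ⋆[ContinuousLinearMap.mul ℝ ℝ, volume]
        fun x => ‖g x‖) x := by
    refine integral_mono (integrable_conv hE hg).norm
      (hE.norm.integrable_convolution (ContinuousLinearMap.mul ℝ ℝ) hg.norm) fun x => ?_
    refine (norm_integral_le_integral_norm _).trans (le_of_eq ?_)
    exact integral_congr_ae (Eventually.of_forall fun y => by simp)
  have h3 : ∫ x, ((fun x => ‖evenPart f x‖) ⋆[ContinuousLinearMap.mul ℝ ℝ, volume]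
        fun x => ‖g x‖) x = (∫ x, ‖evenPart f x‖) * ∫ x, ‖g x‖ := by
    have := integral_convolution (ContinuousLinearMap.mul ℝ ℝ) hE.norm hg.norm
      (μ := (volume : Measure ℝ)) (ν := (volume : Measure ℝ))
    simpa using this
  have h4 : ∫ x, ‖evenPart f x‖ ≤ ∫ x, ‖f x‖ := by
    have e : ∫ x, (‖f x‖ + ‖f (-x)‖) / 2 = ∫ x, ‖f x‖ := by
      rw [integral_div, integral_add hf.norm hf.comp_neg.norm,
        integral_neg_eq_self (fun x => ‖f x‖)]
      ring
    rw [← e]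
    refine integral_mono hE.norm ((hf.norm.add hf.comp_neg.norm).div_const 2) fun x => ?_
    simp only [evenPart, norm_div, Complex.norm_ofNat]
    gcongr
    exact norm_add_le _ _
  rw [h1]
  refine (h2.trans h3.le).trans ?_
  gcongr

/-! ### The Banach algebra `(L¹(ℝ), ⋆_c)` -/

/-- The complex Banach space `L¹(ℝ)` (Lebesgue measure), as a type of its own that will carry the
cosine convolution as its product. -/
def L1Cos : Type := Lp ℂ 1 (volume : Measure ℝ)

namespace L1Cos

instance : NormedAddCommGroup L1Cos :=
  inferInstanceAs (NormedAddCommGroup (Lp ℂ 1 (volume : Measure ℝ)))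

instance : NormedSpace ℂ L1Cos :=
  inferInstanceAs (NormedSpace ℂ (Lp ℂ 1 (volume : Measure ℝ)))

instance : CompleteSpace L1Cos :=
  inferInstanceAs (CompleteSpace (Lp ℂ 1 (volume : Measure ℝ)))

/-- The underlying element of Mathlib's space `L¹`. -/
def toLp (f : L1Cos) : Lp ℂ 1 (volume : Measure ℝ) := f

/-- A representative of an element of `L¹(ℝ)`. -/
instance : CoeFun L1Cos fun _ => ℝ → ℂ := ⟨fun f => (toLp f : ℝ → ℂ)⟩

theorem integrable (f : L1Cos) : Integrable (f : ℝ → ℂ) := L1.integrable_coeFn (toLp f)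

/-- The class in `L¹(ℝ)` of an integrable function. -/
def mk (f : ℝ → ℂ) (hf : Integrable f) : L1Cos := hf.toL1 f

theorem coe_mk (f : ℝ → ℂ) (hf : Integrable f) : (mk f hf : ℝ → ℂ) =ᵐ[volume] f :=
  hf.coeFn_toL1

theorem ext_ae {f g : L1Cos} (h : (f : ℝ → ℂ) =ᵐ[volume] g) : f = g := Lp.ext h

theorem coe_add (f g : L1Cos) : ((f + g : L1Cos) : ℝ → ℂ) =ᵐ[volume] (f : ℝ → ℂ) + g :=
  Lp.coeFn_add (toLp f) (toLp g)

theorem coe_smul (c : ℂ) (f : L1Cos) :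
    ((c • f : L1Cos) : ℝ → ℂ) =ᵐ[volume] c • (f : ℝ → ℂ) :=
  Lp.coeFn_smul c (toLp f)

theorem norm_eq (f : L1Cos) : ‖f‖ = ∫ x, ‖f x‖ := L1.norm_eq_integral_norm (toLp f)

/-- The product of the algebra is the cosine convolution. -/
instance : Mul L1Cos := ⟨fun f g => mk (cosConv f g) (integrable_cosConv f.integrable g.integrable)⟩

theorem coe_mul (f g : L1Cos) : ((f * g : L1Cos) : ℝ → ℂ) =ᵐ[volume] cosConv f g :=
  coe_mk _ _

theorem coe_mul' (f g : L1Cos) : ((f * g : L1Cos) : ℝ → ℂ) =ᵐ[volume] usualConv (evenPart f) g :=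
  (coe_mul f g).trans (cosConv_ae_eq f.integrable g.integrable)

theorem cos_mul_add (f g k : L1Cos) : f * (g + k) = f * g + f * k := by
  apply ext_ae
  refine (coe_mul' _ _).trans ?_
  rw [conv_congr (ae_eq_refl _) (coe_add g k)]
  refine (conv_add_right (integrable_evenPart f.integrable) g.integrable k.integrable).trans ?_
  exact ((coe_mul' f g).symm.add (coe_mul' f k).symm).trans (coe_add _ _).symm

theorem cos_add_mul (f g k : L1Cos) : (f + g) * k = f * k + g * k := by
  apply ext_ae
  refine (coe_mul' _ _).trans ?_
  have e : evenPart ((f : ℝ → ℂ) + g) = evenPart f + evenPart g := by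
    ext x; simp only [evenPart, Pi.add_apply]; ring
  rw [conv_congr (evenPart_congr (coe_add f g)) (ae_eq_refl _), e]
  refine (conv_add_left (integrable_evenPart f.integrable) (integrable_evenPart g.integrable)
    k.integrable).trans ?_
  exact ((coe_mul' f k).symm.add (coe_mul' g k).symm).trans (coe_add _ _).symm

theorem cos_mul_assoc (f g k : L1Cos) : f * g * k = f * (g * k) := by
  apply ext_ae
  refine (coe_mul' _ _).trans ?_
  have hf := integrable_evenPart f.integrable
  have hg := integrable_evenPart g.integrable
  rw [conv_congr ((evenPart_congr (coe_mul' f g)).trans (evenPart_conv f.integrable g.integrable))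
    (ae_eq_refl _)]
  refine (conv_assoc hf hg k.integrable).trans ?_
  rw [← conv_congr (ae_eq_refl (evenPart f)) (coe_mul' g k)]
  exact (coe_mul' f (g * k)).symm

theorem cos_norm_mul_le (f g : L1Cos) : ‖f * g‖ ≤ ‖f‖ * ‖g‖ := by
  have e : ∫ x, ‖(f * g) x‖ = ∫ x, ‖cosConv f g x‖ :=
    integral_congr_ae ((coe_mul f g).fun_comp norm)
  rw [norm_eq, norm_eq, norm_eq, e]
  exact integral_norm_cosConv_le f.integrable g.integrable

theorem cos_smul_mul (c : ℂ) (f g : L1Cos) : (c • f) * g = c • (f * g) := by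
  apply ext_ae
  refine (coe_mul _ _).trans (EventuallyEq.trans ?_ (coe_smul c (f * g)).symm)
  rw [cosConv_congr (coe_smul c f) (ae_eq_refl _)]
  filter_upwards [coe_mul f g] with x hx
  rw [Pi.smul_apply, hx, cosConv, cosConv, smul_eq_mul, ← integral_const_mul]
  simp only [Pi.smul_apply, smul_eq_mul, mul_assoc]

theorem cos_mul_smul (c : ℂ) (f g : L1Cos) : f * (c • g) = c • (f * g) := by
  apply ext_ae
  refine (coe_mul _ _).trans (EventuallyEq.trans ?_ (coe_smul c (f * g)).symm)
  rw [cosConv_congr (ae_eq_refl _) (coe_smul c g)]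
  filter_upwards [coe_mul f g] with x hx
  rw [Pi.smul_apply, hx, cosConv, cosConv, smul_eq_mul, ← integral_const_mul]
  refine integral_congr_ae (Eventually.of_forall fun y => ?_)
  simp only [Pi.smul_apply, smul_eq_mul]
  ring

/-- `(L¹(ℝ), ⋆_c)` is a normed ring, hence (with the next two instances and completeness) a complex
Banach algebra; it is neither unital nor commutative. -/
instance : NonUnitalNormedRing L1Cos where
  __ := (inferInstance : NormedAddCommGroup L1Cos)
  mul := (· * ·)
  left_distrib := cos_mul_add
  right_distrib := cos_add_mul
  zero_mul f := by simpa using cos_smul_mul 0 0 f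
  mul_zero f := by simpa using cos_mul_smul 0 f 0
  mul_assoc := cos_mul_assoc
  norm_mul_le := cos_norm_mul_le

instance : IsScalarTower ℂ L1Cos L1Cos := ⟨cos_smul_mul⟩

instance : SMulCommClass ℂ L1Cos L1Cos := ⟨fun c f g => (cos_mul_smul c f g).symm⟩

end L1Cos

/-! ### Structure space and Gelfand transform of a Banach algebra -/

section Gelfand

variable (A : Type*) [NonUnitalNormedRing A] [NormedSpace ℂ A]

/-- The structure space `Δ(A)`: the nonzero continuous linear multiplicative functionals on `A`,
with the weak* topology. -/
abbrev StructureSpace : Type _ := WeakDual.characterSpace ℂ A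

variable {A}

theorem norm_character_le (m : StructureSpace A) (a : A) : ‖m a‖ ≤ ‖a‖ := by
  set φ : A →L[ℂ] ℂ := WeakDual.CharacterSpace.toCLM m with hφ
  have hm : ∀ a, φ a = m a := fun a => rfl
  have hsq : ∀ a : A, ‖φ a‖ ≤ √‖φ‖ * ‖a‖ := fun a => by
    have h1 : ‖φ a‖ ^ 2 ≤ ‖φ‖ * ‖a‖ ^ 2 := by
      have : ‖φ (a * a)‖ ≤ ‖φ‖ * ‖a * a‖ := φ.le_opNorm _
      rw [hm, map_mul, norm_mul, ← hm] at this
      nlinarith [norm_mul_le a a, norm_nonneg φ]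
    refine le_of_sq_le_sq ?_ (by positivity)
    rwa [mul_pow, Real.sq_sqrt (norm_nonneg φ)]
  have h2 : ‖φ‖ ≤ √‖φ‖ := φ.opNorm_le_bound (Real.sqrt_nonneg _) hsq
  have h3 : ‖φ‖ ≤ 1 := by
    have := Real.sq_sqrt (norm_nonneg φ)
    nlinarith [norm_nonneg φ, Real.sqrt_nonneg ‖φ‖]
  calc ‖m a‖ = ‖φ a‖ := rfl
    _ ≤ ‖φ‖ * ‖a‖ := φ.le_opNorm a
    _ ≤ 1 * ‖a‖ := by gcongr
    _ = ‖a‖ := one_mul _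

theorem continuous_eval (a : A) : Continuous fun m : StructureSpace A => m a :=
  (WeakDual.eval_continuous a).comp continuous_subtype_val

theorem isCompact_norm_ge (a : A) {ε : ℝ} (hε : 0 < ε) :
    IsCompact {m : StructureSpace A | ε ≤ ‖m a‖} := by
  rw [Subtype.isCompact_iff]
  have himg : (Subtype.val '' {m : StructureSpace A | ε ≤ ‖m a‖} : Set (WeakDual ℂ A)) =
      (WeakDual.toStrongDual ⁻¹' Metric.closedBall (0 : StrongDual ℂ A) 1) ∩
        ({φ | ∀ x y, φ (x * y) = φ x * φ y} ∩ {φ | ε ≤ ‖φ a‖}) := by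
    ext φ
    constructor
    · rintro ⟨m, hm, rfl⟩
      refine ⟨?_, m.2.2, hm⟩
      rw [Set.mem_preimage, mem_closedBall_zero_iff]
      exact ContinuousLinearMap.opNorm_le_bound _ zero_le_one fun x => by
        rw [one_mul]; exact norm_character_le m x
    · rintro ⟨-, h2, h3⟩
      refine ⟨⟨φ, ?_, h2⟩, h3, rfl⟩
      rintro rfl
      have h4 : ε ≤ ‖(0 : WeakDual ℂ A) a‖ := h3
      have h5 : (0 : WeakDual ℂ A) a = 0 := rfl
      rw [h5, norm_zero] at h4
      linarith
  rw [himg]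
  refine (WeakDual.isCompact_closedBall _ _).inter_right (IsClosed.inter ?_ ?_)
  · simp only [Set.ofPred_forall]
    exact isClosed_iInter fun x => isClosed_iInter fun y =>
      isClosed_eq (WeakDual.eval_continuous _)
        ((WeakDual.eval_continuous x).mul (WeakDual.eval_continuous y))
  · exact isClosed_le continuous_const (WeakDual.eval_continuous a).norm

variable (A)

/-- The Gelfand transform `Γ : A → C₀(Δ(A))`, `Γ(a)(m) = m(a)`, an algebra homomorphism. -/
def gelfandTransform : A →ₙₐ[ℂ] C₀(StructureSpace A, ℂ) where
  toFun a :=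
    { toFun := fun m => m a
      continuous_toFun := continuous_eval a
      zero_at_infty' := by
        rw [Metric.tendsto_nhds]
        intro ε hε
        filter_upwards [(isCompact_norm_ge a hε).compl_mem_cocompact] with m hm
        simpa using hm }
  map_smul' c a := by ext m; exact map_smul m c a
  map_zero' := by ext m; exact map_zero m
  map_add' a b := by ext m; exact map_add m a b
  map_mul' a b := by ext m; exact map_mul m a b

end Gelfand

/-- The classical cosine transform of a function on the real line. -/
def cosineTransform (f : ℝ → ℂ) (y : ℝ≥0) : ℂ :=
  ∫ x : ℝ, f x * (Real.cos (2 * Real.pi * y * x) : ℂ)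

end CosineGelfand

end

open CosineGelfand

/-! Write `e_c` for `x ↦ exp (-c |x|)`, `Re c > 0`. Everything rests on one resolvent-type identity,
`(c² - 1) e_c ⋆ e_1 = 2c e_1 - 2 e_c` (`usualConv_expAbs_one`). For a character `m` with `u =
m(e_1)` it gives `m(e_c) ((c² - 1) u + 2) = 2c u`.

Since `f ⋆_c g` depends on `f` only through its even part, and `m ≠ 0`, `m` ignores odd parts. By
Weierstrass approximation in the variable `exp (-|x|)`, the `e_n`, `n ≥ 1`, span a dense subspace of
the even functions (`mk_evenPart_mem`). Hence `m` is determined by its values on the `e_n`. If `u =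
0`, they all vanish, which is impossible. So `u ≠ 0`, the factor `(c² - 1) u + 2` has no zero with
`Re c > 0`, and `u` alone determines `m`. The two roots `±c` of that factor must then be purely
imaginary, which forces `u = 2 / (1 + s²)` with `s` real.

The cosine transform at `y` is a character with `u = 2 / (1 + (2πy)²)`, so it is `m` when `2πy =
|s|`. Solving for `y` gives a continuous function of `u`, hence of `m` in the weak* topology; the
inverse is continuous by dominated convergence. -/

open scoped FourierTransform

noncomputable section

namespace CosineGelfand

open Polynomial

/-! ### The functions `x ↦ exp (-c |x|)` -/

/-- The function `x ↦ exp (-c |x|)`. -/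
def expAbs (c : ℂ) (x : ℝ) : ℂ := Complex.exp (-c * (|x| : ℝ))

theorem expAbs_neg (c : ℂ) (x : ℝ) : expAbs c (-x) = expAbs c x := by
  simp only [expAbs, abs_neg]

theorem evenPart_expAbs (c : ℂ) : evenPart (expAbs c) = expAbs c := by
  ext x
  rw [evenPart, expAbs_neg]
  ring

theorem expAbs_of_nonneg (c : ℂ) {x : ℝ} (hx : 0 ≤ x) : expAbs c x = Complex.exp (-c * x) := by
  rw [expAbs, abs_of_nonneg hx]

theorem expAbs_of_nonpos (c : ℂ) {x : ℝ} (hx : x ≤ 0) : expAbs c x = Complex.exp (c * x) := by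
  rw [expAbs, abs_of_nonpos hx]
  push_cast
  ring_nf

theorem expAbs_one (x : ℝ) : expAbs 1 x = (Real.exp (-|x|) : ℝ) := by
  rw [expAbs, Complex.ofReal_exp]
  push_cast
  ring_nf

theorem integrable_expAbs {c : ℂ} (hc : 0 < c.re) : Integrable (expAbs c) := by
  rw [← integrableOn_univ, ← Set.Iic_union_Ioi (a := (0 : ℝ))]
  refine IntegrableOn.union ?_ ?_
  · exact (integrableOn_exp_mul_complex_Iic hc 0).congr_fun
      (fun x hx => (expAbs_of_nonpos c hx).symm) measurableSet_Iic
  · exact (integrableOn_exp_mul_complex_Ioi (a := -c) (by simpa using hc) 0).congr_fun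
      (fun x hx => (expAbs_of_nonneg c (le_of_lt hx)).symm) measurableSet_Ioi

theorem usualConv_expAbs_neg (a b : ℂ) (x : ℝ) :
    usualConv (expAbs a) (expAbs b) (-x) = usualConv (expAbs a) (expAbs b) x := by
  rw [conv_apply, conv_apply, ← integral_neg_eq_self]
  refine integral_congr_ae (Eventually.of_forall fun y => ?_)
  simp only
  rw [expAbs_neg, ← expAbs_neg b, show -(-x - -y) = x - y by ring]

/-- The integrand is a single exponential on each of `y ≤ 0`, `0 ≤ y ≤ x` and `x < y`, so the
convolution is computed explicitly. The middle piece has rate `1 - c`, whence `c ≠ 1`. -/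
theorem usualConv_expAbs_one_of_nonneg {c : ℂ} (hc : 0 < c.re) (hc1 : c ≠ 1) {x : ℝ}
    (hx : 0 ≤ x) :
    (c ^ 2 - 1) * usualConv (expAbs c) (expAbs 1) x = 2 * c * expAbs 1 x - 2 * expAbs c x := by
  have h1 : 0 < (c + 1).re := by simp only [Complex.add_re, Complex.one_re]; linarith
  have h2 : (-(c + 1)).re < 0 := by rw [Complex.neg_re]; linarith
  have ne1 : c + 1 ≠ 0 := fun h => by rw [h] at h1; simp at h1
  have ne2 : 1 - c ≠ 0 := sub_ne_zero.2 hc1.symm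
  have eIic : Set.EqOn (fun y : ℝ => expAbs c y * expAbs 1 (x - y))
      (fun y => Complex.exp (-x) * Complex.exp ((c + 1) * y)) (Set.Iic 0) := fun y hy => by
    have hy' : y ≤ 0 := hy
    simp only
    rw [expAbs_of_nonpos c hy', expAbs_of_nonneg 1 (by linarith), ← Complex.exp_add,
      ← Complex.exp_add]
    push_cast
    ring_nf
  have eIoc : Set.EqOn (fun y : ℝ => expAbs c y * expAbs 1 (x - y))
      (fun y => Complex.exp (-x) * Complex.exp ((1 - c) * y)) (Set.uIcc 0 x) := fun y hy => by
    rw [Set.uIcc_of_le hx] at hy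
    simp only
    rw [expAbs_of_nonneg c hy.1, expAbs_of_nonneg 1 (by linarith [hy.2]), ← Complex.exp_add,
      ← Complex.exp_add]
    push_cast
    ring_nf
  have eIoi : Set.EqOn (fun y : ℝ => expAbs c y * expAbs 1 (x - y))
      (fun y => Complex.exp x * Complex.exp (-(c + 1) * y)) (Set.Ioi x) := fun y hy => by
    have hy' : x < y := hy
    simp only
    rw [expAbs_of_nonneg c (by linarith), expAbs_of_nonpos 1 (by linarith), ← Complex.exp_add,
      ← Complex.exp_add]
    push_cast
    ring_nf
  have i1 : IntegrableOn (fun y : ℝ => expAbs c y * expAbs 1 (x - y)) (Set.Iic 0) :=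
    IntegrableOn.congr_fun ((integrableOn_exp_mul_complex_Iic h1 0).const_mul _) eIic.symm
      measurableSet_Iic
  have i3 : IntegrableOn (fun y : ℝ => expAbs c y * expAbs 1 (x - y)) (Set.Ioi x) :=
    IntegrableOn.congr_fun ((integrableOn_exp_mul_complex_Ioi h2 x).const_mul _) eIoi.symm
      measurableSet_Ioi
  have i2 : IntegrableOn (fun y : ℝ => expAbs c y * expAbs 1 (x - y)) (Set.Ioi 0) := by
    rw [← Set.Ioc_union_Ioi_eq_Ioi hx]
    refine IntegrableOn.union (IntegrableOn.mono_set ?_ Set.Ioc_subset_Icc_self) i3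
    refine ContinuousOn.integrableOn_Icc (Continuous.continuousOn ?_)
    unfold expAbs
    fun_prop
  rw [conv_apply, ← intervalIntegral.integral_Iic_add_Ioi i1 i2,
    ← intervalIntegral.integral_interval_add_Ioi i2 i3,
    setIntegral_congr_fun measurableSet_Iic eIic, setIntegral_congr_fun measurableSet_Ioi eIoi,
    intervalIntegral.integral_congr eIoc, integral_const_mul, integral_const_mul,
    intervalIntegral.integral_const_mul, integral_exp_mul_complex_Iic h1,
    integral_exp_mul_complex_Ioi h2, integral_exp_mul_complex ne2, expAbs_of_nonneg 1 hx,
    expAbs_of_nonneg c hx]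
  have e1 : Complex.exp (x : ℂ) * (-Complex.exp (-(c + 1) * x) / -(c + 1))
      = Complex.exp (-c * x) / (c + 1) := by
    rw [neg_div_neg_eq, ← mul_div_assoc, ← Complex.exp_add]
    ring_nf
  have e2 : Complex.exp (-x : ℂ) * ((Complex.exp ((1 - c) * x) - Complex.exp ((1 - c) * (0 : ℝ)))
      / (1 - c)) = (Complex.exp (-c * x) - Complex.exp (-x)) / (1 - c) := by
    rw [← mul_div_assoc, mul_sub, ← Complex.exp_add, ← Complex.exp_add]
    push_cast
    ring_nf
  rw [e1, e2]
  simp only [Complex.ofReal_zero, mul_zero, Complex.exp_zero, neg_mul, one_mul]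
  field_simp
  ring

theorem usualConv_expAbs_one {c : ℂ} (hc : 0 < c.re) (x : ℝ) :
    (c ^ 2 - 1) * usualConv (expAbs c) (expAbs 1) x = 2 * c * expAbs 1 x - 2 * expAbs c x := by
  rcases eq_or_ne c 1 with rfl | hc1
  -- For `c = 1` both sides vanish.
  · ring
  rcases le_total 0 x with hx | hx
  · exact usualConv_expAbs_one_of_nonneg hc hc1 hx
  · have := usualConv_expAbs_one_of_nonneg hc hc1 (neg_nonneg.2 hx)
    rwa [usualConv_expAbs_neg, expAbs_neg, expAbs_neg] at this

/-! ### Relations satisfied by every character -/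

namespace L1Cos

theorem mk_congr {f g : ℝ → ℂ} (hf : Integrable f) (hg : Integrable g) (h : f =ᵐ[volume] g) :
    mk f hf = mk g hg :=
  ext_ae ((coe_mk f hf).trans (h.trans (coe_mk g hg).symm))

theorem mk_coe (f : L1Cos) : mk f f.integrable = f := ext_ae (coe_mk _ _)

theorem mk_add {f g : ℝ → ℂ} (hf : Integrable f) (hg : Integrable g) :
    mk (f + g) (hf.add hg) = mk f hf + mk g hg :=
  Integrable.toL1_add f g hf hg

theorem mk_sub {f g : ℝ → ℂ} (hf : Integrable f) (hg : Integrable g) :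
    mk (f - g) (hf.sub hg) = mk f hf - mk g hg :=
  Integrable.toL1_sub f g hf hg

theorem mk_smul (c : ℂ) {f : ℝ → ℂ} (hf : Integrable f) :
    mk (c • f) (hf.smul c) = c • mk f hf :=
  Integrable.toL1_smul f hf c

theorem norm_mk (f : ℝ → ℂ) (hf : Integrable f) : ‖mk f hf‖ = ∫ x, ‖f x‖ := by
  rw [norm_eq]
  exact integral_congr_ae ((coe_mk f hf).fun_comp norm)

theorem dist_mk {f g : ℝ → ℂ} (hf : Integrable f) (hg : Integrable g) :
    dist (mk f hf) (mk g hg) = ∫ x, ‖f x - g x‖ := by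
  rw [dist_eq_norm, ← mk_sub hf hg, norm_mk]
  rfl

theorem mk_mul {f g : ℝ → ℂ} (hf : Integrable f) (hg : Integrable g) :
    mk f hf * mk g hg
      = mk (usualConv (evenPart f) g) (integrable_conv (integrable_evenPart hf) hg) := by
  refine ext_ae ((coe_mul' _ _).trans ?_)
  rw [conv_congr (evenPart_congr (coe_mk f hf)) (coe_mk g hg)]
  exact (coe_mk _ _).symm

/-- The class of `x ↦ exp (-c |x|)` in `L¹(ℝ)`, for `c` with positive real part. -/
def expAbsL1 (c : ℂ) (hc : 0 < c.re) : L1Cos := mk (expAbs c) (integrable_expAbs hc)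

theorem one_re_pos : 0 < (1 : ℂ).re := by simp

theorem expAbsL1_mul_one {c : ℂ} (hc : 0 < c.re) :
    (c ^ 2 - 1) • (expAbsL1 c hc * expAbsL1 1 one_re_pos)
      = (2 * c) • expAbsL1 1 one_re_pos - (2 : ℂ) • expAbsL1 c hc := by
  simp only [expAbsL1]
  rw [mk_mul, ← mk_smul, ← mk_smul, ← mk_smul, ← mk_sub]
  refine mk_congr _ _ (Eventually.of_forall fun x => ?_)
  rw [evenPart_expAbs]
  exact usualConv_expAbs_one hc x

/-- A character takes related values on the functions `exp (-c |x|)`. -/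
theorem character_expAbsL1 (m : StructureSpace L1Cos) {c : ℂ} (hc : 0 < c.re) :
    (c ^ 2 - 1) * (m (expAbsL1 c hc) * m (expAbsL1 1 one_re_pos))
      = 2 * c * m (expAbsL1 1 one_re_pos) - 2 * m (expAbsL1 c hc) := by
  have := congrArg m (expAbsL1_mul_one hc)
  simpa only [map_smul, map_sub, map_mul, smul_eq_mul] using this

/-- A character does not see the odd part of a function. -/
theorem character_mk_evenPart (m : StructureSpace L1Cos) {f : ℝ → ℂ} (hf : Integrable f) :
    m (mk (evenPart f) (integrable_evenPart hf)) = m (mk f hf) := by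
  -- The products of `f` and of its even part with any `g` coincide; choosing `m g ≠ 0` allows
  -- cancellation.
  obtain ⟨g, hg⟩ : ∃ g, m g ≠ 0 := by
    by_contra! h
    exact m.2.1 (ContinuousLinearMap.ext h)
  refine mul_right_cancel₀ hg ?_
  rw [← map_mul, ← map_mul, ← mk_coe g, mk_mul, mk_mul]
  congr 1
  refine mk_congr _ _ (Eventually.of_forall fun x => ?_)
  have : evenPart (evenPart f) = evenPart f := by
    ext y
    simp only [evenPart, neg_neg]
    ring
  rw [this]

end L1Cos

/-! ### Density of the exponentials among the even functions -/

theorem exists_complex_polynomial_near {h : ℝ → ℂ} (hh : Continuous h) {ε : ℝ} (hε : 0 < ε) :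
    ∃ P : ℂ[X], ∀ t ∈ Set.Icc (0 : ℝ) 1, ‖h t - P.eval (t : ℂ)‖ ≤ ε := by
  obtain ⟨p, hp⟩ := exists_polynomial_near_of_continuousOn 0 1 (fun t => (h t).re)
    (Complex.continuous_re.comp hh).continuousOn (ε / 2) (half_pos hε)
  obtain ⟨q, hq⟩ := exists_polynomial_near_of_continuousOn 0 1 (fun t => (h t).im)
    (Complex.continuous_im.comp hh).continuousOn (ε / 2) (half_pos hε)
  refine ⟨p.map (algebraMap ℝ ℂ) + C Complex.I * q.map (algebraMap ℝ ℂ), fun t ht => ?_⟩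
  have e : ∀ r : ℝ[X], (r.map (algebraMap ℝ ℂ)).eval (t : ℂ) = ((r.eval t : ℝ) : ℂ) := fun r =>
    eval_map_apply (algebraMap ℝ ℂ) t
  rw [eval_add, eval_mul, eval_C, e, e]
  refine (Complex.norm_le_abs_re_add_abs_im _).trans ?_
  have h1 := hp t ht
  have h2 := hq t ht
  rw [abs_sub_comm] at h1 h2
  simp only [Complex.sub_re, Complex.add_re, Complex.mul_re, Complex.I_re, Complex.I_im,
    Complex.ofReal_re, Complex.ofReal_im, Complex.sub_im, Complex.add_im, Complex.mul_im,
    zero_mul, one_mul, mul_zero, sub_zero, add_zero, zero_add]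
  linarith

/-- This is `G(x) / exp (-x)` in the variable `t = exp (-x)`. Near `t = 0` the logarithm leaves the
support of `G`, so the function vanishes there. -/
theorem continuous_comp_neg_log_div {G : ℝ → ℂ} (hG : Continuous G) (hs : HasCompactSupport G) :
    Continuous fun t : ℝ => G (-Real.log t) / t := by
  rw [continuous_iff_continuousAt]
  intro t
  rcases eq_or_ne t 0 with rfl | ht
  · rw [hasCompactSupport_iff_eventuallyEq, coclosedCompact_eq_cocompact] at hs
    have h1 : ∀ᶠ t : ℝ in 𝓝[≠] 0, G (-Real.log t) = 0 :=
      (tendsto_neg_atBot_atTop.comp Real.tendsto_log_nhdsNE_zero).eventually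
        (hs.filter_mono atTop_le_cocompact)
    rw [eventually_nhdsWithin_iff] at h1
    have h2 : (fun t : ℝ => G (-Real.log t) / t) =ᶠ[𝓝 0] fun _ => 0 := by
      filter_upwards [h1] with s hs
      -- At `s = 0` the value is `0` by the convention for division by zero, whatever `G 0` is.
      rcases eq_or_ne s 0 with rfl | h0
      · simp
      · rw [hs h0, zero_div]
    exact continuousAt_const.congr h2.symm
  · exact (hG.continuousAt.comp (Real.continuousAt_log ht).neg).div
      Complex.continuous_ofReal.continuousAt (Complex.ofReal_ne_zero.2 ht)

/-- The exponential polynomial `x ↦ exp (-|x|) P (exp (-|x|))`. -/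
def expPoly (P : ℂ[X]) (x : ℝ) : ℂ := expAbs 1 x * P.eval (expAbs 1 x)

theorem expPoly_add (P Q : ℂ[X]) : expPoly (P + Q) = expPoly P + expPoly Q := by
  ext x
  simp only [expPoly, eval_add, Pi.add_apply]
  ring

theorem natCast_add_one_re_pos (n : ℕ) : 0 < ((n : ℂ) + 1).re := by
  simp only [Complex.add_re, Complex.natCast_re, Complex.one_re]
  positivity

/-- The extra factor `exp (-|x|)` shifts the exponent to `n + 1`, so that even constant polynomials
give integrable functions. -/
theorem expPoly_monomial (n : ℕ) (a : ℂ) :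
    expPoly (monomial n a) = a • expAbs ((n : ℂ) + 1) := by
  ext x
  have : expAbs ((n : ℂ) + 1) x = expAbs 1 x * expAbs 1 x ^ n := by
    rw [← pow_succ', expAbs, expAbs, ← Complex.exp_nat_mul]
    push_cast
    ring_nf
  rw [expPoly, eval_monomial, Pi.smul_apply, smul_eq_mul, this]
  ring

theorem integrable_expPoly (P : ℂ[X]) : Integrable (expPoly P) := by
  induction P using Polynomial.induction_on' with
  | add p q hp hq => rw [expPoly_add]; exact hp.add hq
  | monomial n a =>
    rw [expPoly_monomial]
    exact (integrable_expAbs (natCast_add_one_re_pos n)).smul a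

theorem integrable_exp_neg_abs : Integrable fun x : ℝ => Real.exp (-|x|) := by
  refine (integrable_expAbs L1Cos.one_re_pos).norm.congr (Eventually.of_forall fun x => ?_)
  simp only [expAbs_one, Complex.norm_real, Real.norm_eq_abs, Real.abs_exp]

/-- Weierstrass is applied to `G(-log t) / t` rather than to `G(-log t)`: multiplying back by `t =
exp (-|x|)` turns the uniform error into an integrable one. -/
theorem exists_expPoly_near {G : ℝ → ℂ} (hG : Continuous G) (hs : HasCompactSupport G)
    (he : ∀ x, G (-x) = G x) {ε : ℝ} (hε : 0 < ε) :
    ∃ P : ℂ[X], ∀ x, ‖G x - expPoly P x‖ ≤ ε * Real.exp (-|x|) := by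
  obtain ⟨P, hP⟩ := exists_complex_polynomial_near (continuous_comp_neg_log_div hG hs) hε
  refine ⟨P, fun x => ?_⟩
  have h1 := hP (Real.exp (-|x|)) ⟨(Real.exp_pos _).le, Real.exp_le_one_iff.2 (by simp)⟩
  have h2 : G |x| = G x := by
    rcases abs_cases x with h | h <;> rw [h.1]
    exact he x
  have h3 : ((Real.exp (-|x|) : ℝ) : ℂ) ≠ 0 := Complex.ofReal_ne_zero.2 (Real.exp_pos _).ne'
  rw [Real.log_exp, neg_neg, h2] at h1
  have h4 : G x - expPoly P x = (G x / (Real.exp (-|x|) : ℝ) - P.eval ((Real.exp (-|x|) : ℝ) : ℂ))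
      * (Real.exp (-|x|) : ℝ) := by
    rw [expPoly, expAbs_one, sub_mul, div_mul_cancel₀ _ h3, mul_comm (eval _ _)]
  rw [h4, norm_mul, Complex.norm_real, Real.norm_eq_abs, Real.abs_exp]
  gcongr

theorem integral_norm_evenPart_sub_le {f g : ℝ → ℂ} (hf : Integrable f) (hg : Integrable g) :
    ∫ x, ‖evenPart f x - evenPart g x‖ ≤ ∫ x, ‖f x - g x‖ := by
  have hd : Integrable fun x => ‖f x - g x‖ := (hf.sub hg).norm
  have e : ∫ x, (‖f x - g x‖ + ‖f (-x) - g (-x)‖) / 2 = ∫ x, ‖f x - g x‖ := by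
    rw [integral_div, integral_add hd hd.comp_neg, integral_neg_eq_self (fun x => ‖f x - g x‖)]
    ring
  rw [← e]
  refine integral_mono ((integrable_evenPart hf).sub (integrable_evenPart hg)).norm
    ((hd.add hd.comp_neg).div_const 2) fun x => ?_
  have : evenPart f x - evenPart g x = ((f x - g x) + (f (-x) - g (-x))) / 2 := by
    simp only [evenPart]
    ring
  simp only [this, norm_div, Complex.norm_ofNat]
  gcongr
  exact norm_add_le _ _

theorem hasCompactSupport_evenPart {g : ℝ → ℂ} (hg : HasCompactSupport g) :
    HasCompactSupport (evenPart g) := by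
  have h1 : HasCompactSupport fun x => g x + g (-x) :=
    hg.add (hg.comp_homeomorph (Homeomorph.neg ℝ))
  have h2 : evenPart g = fun x => (g x + g (-x)) * (2 : ℂ)⁻¹ := by
    ext x
    rw [evenPart, div_eq_mul_inv]
  rw [h2]
  exact h1.mul_right

/-! ### Density in `L¹` and the value of a character on `exp (-|x|)` -/

namespace L1Cos

/-- A closed subspace containing the functions `exp (-n |x|)`, `n ≥ 1`, contains all even parts. -/
theorem mk_evenPart_mem {S : Submodule ℂ L1Cos} (hS : IsClosed (S : Set L1Cos))
    (h : ∀ n : ℕ, expAbsL1 ((n : ℂ) + 1) (natCast_add_one_re_pos n) ∈ S)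
    {f : ℝ → ℂ} (hf : Integrable f) : mk (evenPart f) (integrable_evenPart hf) ∈ S := by
  have hP : ∀ P : ℂ[X], mk (expPoly P) (integrable_expPoly P) ∈ S := fun P => by
    induction P using Polynomial.induction_on' with
    | add p q hp hq =>
      rw [mk_congr _ ((integrable_expPoly p).add (integrable_expPoly q))
        (Eventually.of_forall fun x => congrFun (expPoly_add p q) x),
        mk_add (integrable_expPoly p) (integrable_expPoly q)]
      exact S.add_mem hp hq
    | monomial n a =>
      rw [mk_congr _ ((integrable_expAbs (natCast_add_one_re_pos n)).smul a)
        (Eventually.of_forall fun x => congrFun (expPoly_monomial n a) x),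
        mk_smul a (integrable_expAbs (natCast_add_one_re_pos n))]
      exact S.smul_mem a (h n)
  have hI : 0 ≤ ∫ x : ℝ, Real.exp (-|x|) := integral_nonneg fun x => (Real.exp_pos _).le
  have hC : ∀ {G : ℝ → ℂ} (hi : Integrable G), Continuous G → HasCompactSupport G →
      (∀ x, G (-x) = G x) → mk G hi ∈ S := fun {G} hi hG hs he => by
    rw [← SetLike.mem_coe, ← hS.closure_eq, Metric.mem_closure_iff]
    intro ε hε
    obtain ⟨P, hP'⟩ := exists_expPoly_near hG hs he
      -- The `+ 1` keeps the denominator positive and makes the final bound strict.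
      (ε := ε / ((∫ x : ℝ, Real.exp (-|x|)) + 1)) (by positivity)
    refine ⟨_, hP P, ?_⟩
    rw [dist_mk]
    calc ∫ x, ‖G x - expPoly P x‖
        ≤ ∫ x : ℝ, ε / ((∫ x : ℝ, Real.exp (-|x|)) + 1) * Real.exp (-|x|) :=
          integral_mono (hi.sub (integrable_expPoly P)).norm
            (integrable_exp_neg_abs.const_mul _) hP'
      _ = ε * ((∫ x : ℝ, Real.exp (-|x|)) / ((∫ x : ℝ, Real.exp (-|x|)) + 1)) := by
          rw [integral_const_mul]
          ring
      _ < ε := mul_lt_of_lt_one_right hε ((div_lt_one (by positivity)).2 (lt_add_one _))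
  rw [← SetLike.mem_coe, ← hS.closure_eq, Metric.mem_closure_iff]
  intro ε hε
  obtain ⟨g, hgs, hfg, hgc, hgi⟩ := hf.exists_hasCompactSupport_integral_sub_le (half_pos hε)
  refine ⟨_, hC (integrable_evenPart hgi) ?_ (hasCompactSupport_evenPart hgs) fun x => ?_, ?_⟩
  · unfold evenPart
    fun_prop
  · simp only [evenPart, neg_neg]
    ring
  · rw [dist_mk]
    linarith [integral_norm_evenPart_sub_le hf hgi]

/-- The values of a character on the `exp (-n |x|)` are determined by that on `exp (-|x|)`. -/
theorem character_expAbsL1_mul (m : StructureSpace L1Cos) {c : ℂ} (hc : 0 < c.re) :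
    m (expAbsL1 c hc) * ((c ^ 2 - 1) * m (expAbsL1 1 one_re_pos) + 2)
      = 2 * c * m (expAbsL1 1 one_re_pos) := by
  linear_combination character_expAbsL1 m hc

/-- A continuous functional that ignores odd parts is determined by its values on the functions
`exp (-n |x|)`, `n ≥ 1`. -/
theorem eq_of_eq_on_expAbsL1 {φ ψ : L1Cos →L[ℂ] ℂ}
    (hφ : ∀ {f : ℝ → ℂ} (hf : Integrable f),
      φ (mk (evenPart f) (integrable_evenPart hf)) = φ (mk f hf))
    (hψ : ∀ {f : ℝ → ℂ} (hf : Integrable f),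
      ψ (mk (evenPart f) (integrable_evenPart hf)) = ψ (mk f hf))
    (h : ∀ n : ℕ, φ (expAbsL1 ((n : ℂ) + 1) (natCast_add_one_re_pos n))
      = ψ (expAbsL1 ((n : ℂ) + 1) (natCast_add_one_re_pos n))) : φ = ψ := by
  refine ContinuousLinearMap.ext fun f => ?_
  have hcl : IsClosed ((LinearMap.eqLocus (φ : L1Cos →ₗ[ℂ] ℂ) (ψ : L1Cos →ₗ[ℂ] ℂ) :
      Submodule ℂ L1Cos) : Set L1Cos) :=
    isClosed_eq φ.continuous ψ.continuous
  have hmem : φ _ = ψ _ := mk_evenPart_mem hcl h f.integrable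
  rwa [hφ f.integrable, hψ f.integrable, mk_coe] at hmem

/-- If this value were zero, the multiplicative relation would make `m` vanish on every `exp (-n
|x|)`, hence everywhere by density. -/
theorem character_expAbsL1_one_ne_zero (m : StructureSpace L1Cos) :
    m (expAbsL1 1 one_re_pos) ≠ 0 := fun h0 => by
  refine m.2.1 (eq_of_eq_on_expAbsL1 (φ := WeakDual.CharacterSpace.toCLM m) (ψ := 0)
    (fun hf => character_mk_evenPart m hf) (fun _ => rfl) fun n => ?_)
  have := character_expAbsL1_mul m (natCast_add_one_re_pos n)
  rw [h0, mul_zero, mul_zero, zero_add] at this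
  exact (mul_eq_zero.1 this).resolve_right two_ne_zero

/-- A zero of the factor would give `2 c u = 0` with `c` and `u` nonzero. This both determines `m`
from `u` and confines `u` to a real interval. -/
theorem character_expAbsL1_factor_ne_zero (m : StructureSpace L1Cos) {c : ℂ} (hc : 0 < c.re) :
    (c ^ 2 - 1) * m (expAbsL1 1 one_re_pos) + 2 ≠ 0 := fun h => by
  have := character_expAbsL1_mul m hc
  rw [h, mul_zero, eq_comm] at this
  have hc0 : c ≠ 0 := fun h => by simp [h] at hc
  exact mul_ne_zero (mul_ne_zero two_ne_zero hc0) (character_expAbsL1_one_ne_zero m) this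

/-- A character is determined by its value on `exp (-|x|)`. -/
theorem character_eq_of_expAbsL1_one {m m' : StructureSpace L1Cos}
    (h : m (expAbsL1 1 one_re_pos) = m' (expAbsL1 1 one_re_pos)) : m = m' := by
  refine Subtype.ext (eq_of_eq_on_expAbsL1 (φ := WeakDual.CharacterSpace.toCLM m)
    (ψ := WeakDual.CharacterSpace.toCLM m') (fun hf => character_mk_evenPart m hf)
    (fun hf => character_mk_evenPart m' hf) fun n => ?_)
  have hc := natCast_add_one_re_pos n
  refine mul_right_cancel₀ (character_expAbsL1_factor_ne_zero m hc) ?_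
  refine (character_expAbsL1_mul m hc).trans ?_
  rw [h]
  exact (character_expAbsL1_mul m' hc).symm

/-- The value of a character on `exp (-|x|)` is `2 / (1 + s²)` with real `s`. -/
theorem exists_character_expAbsL1_one (m : StructureSpace L1Cos) :
    ∃ s : ℝ, m (expAbsL1 1 one_re_pos) = 2 / (1 + (s : ℂ) ^ 2) := by
  have hu := character_expAbsL1_one_ne_zero m
  set u := m (expAbsL1 1 one_re_pos) with hu'
  -- `c` is chosen to annihilate the factor `(c² - 1) u + 2`; so does `-c`, so neither may have
  -- positive real part.
  obtain ⟨c, hc⟩ := IsAlgClosed.exists_pow_nat_eq (1 - 2 / u) two_pos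
  have key : (c ^ 2 - 1) * u + 2 = 0 := by
    rw [hc]
    field_simp
    ring
  have hre : c.re = 0 := by
    rcases lt_trichotomy c.re 0 with h | h | h
    · refine absurd ?_ (character_expAbsL1_factor_ne_zero m (c := -c) (by simpa using h))
      rwa [neg_sq]
    · exact h
    · exact absurd key (character_expAbsL1_factor_ne_zero m h)
  have hc2 : c ^ 2 = -(c.im : ℂ) ^ 2 := by
    have : c = c.im * Complex.I := by apply Complex.ext <;> simp [hre]
    rw [this, mul_pow, Complex.I_sq]
    simp
  rw [hc2] at key
  have hk : (1 + (c.im : ℂ) ^ 2) * u = 2 := by linear_combination -key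
  refine ⟨c.im, ?_⟩
  have hne : (1 + (c.im : ℂ) ^ 2) ≠ 0 := fun h => by rw [h, zero_mul] at hk; norm_num at hk
  rw [eq_div_iff hne, mul_comm, hk]

end L1Cos

/-! ### The cosine characters -/

theorem norm_mul_cos_le (z : ℂ) (t : ℝ) : ‖z * (Real.cos t : ℂ)‖ ≤ ‖z‖ := by
  rw [norm_mul, Complex.norm_real, Real.norm_eq_abs]
  exact mul_le_of_le_one_right (norm_nonneg z) (Real.abs_cos_le_one t)

theorem aestronglyMeasurable_mul_cos {f : ℝ → ℂ} (hf : Integrable f) (y : ℝ) :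
    AEStronglyMeasurable (fun x : ℝ => f x * (Real.cos (2 * Real.pi * y * x) : ℂ)) volume :=
  hf.aestronglyMeasurable.mul (Continuous.aestronglyMeasurable (by fun_prop))

theorem integrable_mul_cos {f : ℝ → ℂ} (hf : Integrable f) (y : ℝ) :
    Integrable fun x : ℝ => f x * (Real.cos (2 * Real.pi * y * x) : ℂ) :=
  hf.mono (aestronglyMeasurable_mul_cos hf y) (Eventually.of_forall fun _ => norm_mul_cos_le _ _)

theorem norm_cosineTransform_le {f : ℝ → ℂ} (hf : Integrable f) (y : ℝ≥0) :
    ‖cosineTransform f y‖ ≤ ∫ x, ‖f x‖ :=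
  (norm_integral_le_integral_norm _).trans
    (integral_mono (integrable_mul_cos hf y).norm hf.norm fun _ => norm_mul_cos_le _ _)

theorem cosineTransform_congr {f g : ℝ → ℂ} (h : f =ᵐ[volume] g) (y : ℝ≥0) :
    cosineTransform f y = cosineTransform g y := by
  refine integral_congr_ae ?_
  filter_upwards [h] with x hx
  rw [hx]

theorem continuous_cosineTransform {f : ℝ → ℂ} (hf : Integrable f) :
    Continuous (cosineTransform f) := by
  refine continuous_of_dominated (bound := fun x => ‖f x‖)
    (fun y => aestronglyMeasurable_mul_cos hf y)
    (fun y => Eventually.of_forall fun _ => norm_mul_cos_le _ _) hf.norm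
    (Eventually.of_forall fun x => ?_)
  fun_prop

/-- The cosine transform is the Fourier transform of the even part. -/
theorem fourier_evenPart {f : ℝ → ℂ} (hf : Integrable f) (y : ℝ≥0) :
    𝓕 (evenPart f) (y : ℝ) = cosineTransform f y := by
  have hi : ∀ {g : ℝ → ℂ}, Integrable g → Integrable fun x : ℝ =>
      Complex.exp ((-2 * Real.pi * x * y : ℝ) * Complex.I) * g x := fun {g} hg => by
    refine hg.bdd_mul (c := 1) (Continuous.aestronglyMeasurable (by fun_prop))
      (Eventually.of_forall fun x => ?_)
    rw [Complex.norm_exp_ofReal_mul_I]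
  -- Euler's formula; the substitution `x ↦ -x` then moves the reflection from the phase onto `f`.
  have hcos : ∀ x : ℝ, f x * (Real.cos (2 * Real.pi * y * x) : ℂ)
      = (Complex.exp ((-2 * Real.pi * x * y : ℝ) * Complex.I) * f x
        + Complex.exp ((-2 * Real.pi * (-x) * y : ℝ) * Complex.I) * f x) / 2 := fun x => by
    rw [Complex.ofReal_cos, Complex.cos]
    push_cast
    ring_nf
  have hrefl : ∫ x : ℝ, Complex.exp ((-2 * Real.pi * (-x) * y : ℝ) * Complex.I) * f x
      = ∫ x : ℝ, Complex.exp ((-2 * Real.pi * x * y : ℝ) * Complex.I) * f (-x) := by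
    rw [← integral_neg_eq_self]
    simp only [neg_neg]
  have hi' : Integrable fun x : ℝ =>
      Complex.exp ((-2 * Real.pi * (-x) * y : ℝ) * Complex.I) * f x := by
    simpa only [neg_neg] using (hi hf.comp_neg).comp_neg
  rw [Real.fourier_real_eq_integral_exp_smul, cosineTransform]
  simp only [hcos]
  rw [integral_div, integral_add (hi hf) hi', hrefl, ← integral_add (hi hf) (hi hf.comp_neg),
    ← integral_div]
  refine integral_congr_ae (Eventually.of_forall fun x => ?_)
  simp only [evenPart, smul_eq_mul]
  ring

theorem fourier_congr {f g : ℝ → ℂ} (h : f =ᵐ[volume] g) (y : ℝ) : 𝓕 f y = 𝓕 g y := by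
  rw [Real.fourier_real_eq, Real.fourier_real_eq]
  refine integral_congr_ae ?_
  filter_upwards [h] with x hx
  rw [hx]

/-- The even part of `f ⋆_c g` is the usual convolution of the even parts, and the Fourier transform
turns that into a product. -/
theorem cosineTransform_cosConv {f g : ℝ → ℂ} (hf : Integrable f) (hg : Integrable g) (y : ℝ≥0) :
    cosineTransform (cosConv f g) y = cosineTransform f y * cosineTransform g y := by
  have hE := integrable_evenPart hf
  rw [cosineTransform_congr (cosConv_ae_eq hf hg), ← fourier_evenPart (integrable_conv hE hg),
    fourier_congr (evenPart_conv hf hg), ← fourier_evenPart hf, ← fourier_evenPart hg]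
  exact Real.fourier_mul_convolution_eq hE (integrable_evenPart hg) y

theorem cosineTransform_expAbs_one (y : ℝ≥0) :
    cosineTransform (expAbs 1) y = 2 / (1 + ((2 * Real.pi * y : ℝ) : ℂ) ^ 2) := by
  set s : ℝ := 2 * Real.pi * y with hs
  have h1 : 0 < (1 - s * Complex.I).re := by simp
  have h2 : (-1 - s * Complex.I).re < 0 := by simp
  have hI := Complex.I_sq
  have ne : (1 + (s : ℂ) ^ 2) ≠ 0 := by
    have : (1 + s ^ 2 : ℝ) ≠ 0 := by positivity
    exact_mod_cast this
  have ne1 : 1 - s * Complex.I ≠ 0 := fun h => by rw [h] at h1; simp at h1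
  have ne2 : -1 - s * Complex.I ≠ 0 := fun h => by rw [h] at h2; simp at h2
  have eIic : Set.EqOn (fun x : ℝ => Complex.exp ((1 - s * Complex.I) * x))
      (fun x => Complex.exp ((-2 * Real.pi * x * y : ℝ) * Complex.I) • expAbs 1 x)
      (Set.Iic 0) := fun x hx => by
    simp only [smul_eq_mul]
    rw [expAbs_of_nonpos 1 hx, ← Complex.exp_add, hs]
    push_cast
    ring_nf
  have eIoi : Set.EqOn (fun x : ℝ => Complex.exp ((-1 - s * Complex.I) * x))
      (fun x => Complex.exp ((-2 * Real.pi * x * y : ℝ) * Complex.I) • expAbs 1 x)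
      (Set.Ioi 0) := fun x hx => by
    simp only [smul_eq_mul]
    rw [expAbs_of_nonneg 1 (le_of_lt hx), ← Complex.exp_add, hs]
    push_cast
    ring_nf
  rw [← fourier_evenPart (integrable_expAbs L1Cos.one_re_pos), evenPart_expAbs,
    Real.fourier_real_eq_integral_exp_smul, ← intervalIntegral.integral_Iic_add_Ioi
      ((integrableOn_exp_mul_complex_Iic h1 0).congr_fun eIic measurableSet_Iic)
      ((integrableOn_exp_mul_complex_Ioi h2 0).congr_fun eIoi measurableSet_Ioi),
    ← setIntegral_congr_fun measurableSet_Iic eIic, ← setIntegral_congr_fun measurableSet_Ioi eIoi,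
    integral_exp_mul_complex_Iic h1, integral_exp_mul_complex_Ioi h2]
  simp only [Complex.ofReal_zero, mul_zero, Complex.exp_zero]
  rw [div_add_div _ _ ne1 ne2, div_eq_div_iff (mul_ne_zero ne1 ne2) ne]
  linear_combination (-2 * (s : ℂ) ^ 2) * hI

/-! ### The homeomorphism with the half-line -/

namespace L1Cos

/-- The cosine transform at `y` as a continuous linear functional. -/
def cosineFunctional (y : ℝ≥0) : L1Cos →L[ℂ] ℂ :=
  LinearMap.mkContinuous
    { toFun := fun f => cosineTransform f y
      map_add' := fun f g => by
        rw [cosineTransform_congr (coe_add f g)]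
        simp only [cosineTransform, Pi.add_apply, add_mul]
        exact integral_add (integrable_mul_cos f.integrable y) (integrable_mul_cos g.integrable y)
      map_smul' := fun c f => by
        rw [cosineTransform_congr (coe_smul c f)]
        simp only [cosineTransform, Pi.smul_apply, smul_eq_mul, mul_assoc, RingHom.id_apply]
        exact integral_const_mul c _ }
    1 fun f => by
      rw [one_mul, norm_eq]
      exact norm_cosineTransform_le f.integrable y

theorem cosineFunctional_apply (y : ℝ≥0) (f : L1Cos) :
    cosineFunctional y f = cosineTransform f y := rfl

theorem cosineFunctional_expAbsL1_one (y : ℝ≥0) :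
    cosineFunctional y (expAbsL1 1 one_re_pos) = 2 / (1 + ((2 * Real.pi * y : ℝ) : ℂ) ^ 2) := by
  rw [cosineFunctional_apply, expAbsL1, cosineTransform_congr (coe_mk _ _),
    cosineTransform_expAbs_one]

theorem two_div_one_add_sq (s : ℝ) :
    (2 / (1 + (s : ℂ) ^ 2)) = ((2 / (1 + s ^ 2) : ℝ) : ℂ) := by
  push_cast
  rfl

/-- The cosine transform at `y` as a character of `(L¹(ℝ), ⋆_c)`. -/
def cosineCharacter (y : ℝ≥0) : StructureSpace L1Cos :=
  ⟨cosineFunctional y, fun h => by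
    have h1 := cosineFunctional_expAbsL1_one y
    have h2 : cosineFunctional y = 0 := h
    rw [h2, two_div_one_add_sq, zero_apply, eq_comm,
      Complex.ofReal_eq_zero] at h1
    have : (0 : ℝ) < 2 / (1 + (2 * Real.pi * y) ^ 2) := by positivity
    exact this.ne' h1,
  fun f g => by
    change cosineTransform (f * g : L1Cos) y = cosineTransform f y * cosineTransform g y
    rw [cosineTransform_congr (coe_mul f g), cosineTransform_cosConv f.integrable g.integrable]⟩

/-- The parameter of a character, read off from its value on `exp (-|x|)`. -/
def characterParam (m : StructureSpace L1Cos) : ℝ≥0 :=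
  Real.toNNReal (√(2 / (m (expAbsL1 1 one_re_pos)).re - 1) / (2 * Real.pi))

theorem characterParam_cosineCharacter (y : ℝ≥0) : characterParam (cosineCharacter y) = y := by
  have h : cosineCharacter y (expAbsL1 1 one_re_pos)
      = ((2 / (1 + (2 * Real.pi * y) ^ 2) : ℝ) : ℂ) :=
    (cosineFunctional_expAbsL1_one y).trans (two_div_one_add_sq _)
  have hpi := Real.pi_pos
  rw [characterParam, h, Complex.ofReal_re, div_div_cancel₀ two_ne_zero, add_sub_cancel_left,
    Real.sqrt_sq (by positivity), mul_div_cancel_left₀ _ (by positivity), Real.toNNReal_coe]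

theorem exists_cosineCharacter_eq (m : StructureSpace L1Cos) : ∃ y, cosineCharacter y = m := by
  obtain ⟨s, hs⟩ := exists_character_expAbsL1_one m
  -- Solves `2πy = |s|`; the sign of `s` is irrelevant because only `s²` occurs.
  refine ⟨Real.toNNReal (|s| / (2 * Real.pi)), character_eq_of_expAbsL1_one ?_⟩
  refine (cosineFunctional_expAbsL1_one _).trans ?_
  rw [hs, Real.coe_toNNReal _ (by positivity), mul_div_cancel₀ _ (by positivity),
    ← Complex.ofReal_pow, sq_abs, Complex.ofReal_pow]

theorem cosineCharacter_characterParam (m : StructureSpace L1Cos) :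
    cosineCharacter (characterParam m) = m := by
  obtain ⟨y, rfl⟩ := exists_cosineCharacter_eq m
  rw [characterParam_cosineCharacter]

theorem continuous_cosineCharacter : Continuous cosineCharacter :=
  Continuous.subtype_mk (WeakDual.continuous_of_continuous_eval fun f =>
    continuous_cosineTransform f.integrable) _

theorem continuous_characterParam : Continuous characterParam := by
  refine continuous_real_toNNReal.comp (Continuous.div_const (Real.continuous_sqrt.comp
    ((continuous_const.div (Complex.continuous_re.comp (continuous_eval _)) fun m => ?_).sub
      continuous_const)) _)
  -- The form `2 / (1 + s²)` shows that the denominator never vanishes.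
  obtain ⟨s, hs⟩ := exists_character_expAbsL1_one m
  rw [Function.comp_apply, hs, two_div_one_add_sq, Complex.ofReal_re]
  positivity

/-- The structure space of `(L¹(ℝ), ⋆_c)` is the half-line. -/
def structureSpaceHomeomorph : StructureSpace L1Cos ≃ₜ ℝ≥0 where
  toFun := characterParam
  invFun := cosineCharacter
  left_inv := cosineCharacter_characterParam
  right_inv := characterParam_cosineCharacter
  continuous_toFun := continuous_characterParam
  continuous_invFun := continuous_cosineCharacter

end L1Cos

end CosineGelfand

end

theorem mainTheorem3 :
    ∃ h : StructureSpace L1Cos ≃ₜ ℝ≥0,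
      (∀ (m : StructureSpace L1Cos) (y : ℝ≥0),
        h m = y ↔ ∀ f : L1Cos, m f = ∫ x : ℝ, f x * (Real.cos (2 * Real.pi * y * x) : ℂ)) ∧
      (∀ (f : L1Cos) (y : ℝ≥0),
        gelfandTransform L1Cos f (h.symm y) = cosineTransform f y) := by
  refine ⟨L1Cos.structureSpaceHomeomorph, fun m y => ?_, fun f y => rfl⟩
  -- The inverse map is by definition the cosine character, so the claim becomes equality of two
  -- characters.
  rw [← Homeomorph.eq_symm_apply]
  constructor
  · rintro rfl f
    rfl
  · intro h
    exact WeakDual.CharacterSpace.ext h
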